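/- For real $\nu$ and $x>0$ let $$I_\nu(x)=\Big(\frac{x}{2}\Big)^{\nu}\sum_{k=0}^\infty\frac{(x^2/4)^k}{k!\,\Gamma(\nu+k+1)},\qquad K_\nu(x)=\int_0^\infty e^{-x\cosh t}\cosh(\nu t)\,dt$$ be the modified Bessel functions of the first and second kind, and let $$\mathbf{L}_\nu(x)=\Big(\frac{x}{2}\Big)^{\nu+1}\sum_{k=0}^\infty\frac{(x/2)^{2k}}{\Gamma(k+\frac32)\,\Gamma(k+\nu+\frac32)}$$ be the modified Struve function (with the convention $1/\Gamma=0$ at the poles of $\Gamma$). (i) If $\nu>\frac12$, then for all $x>0$, $$\frac{x^{\nu}K_{\nu}(x)}{\sqrt{\pi}\,2^{\nu-1}\Gamma(\nu+\frac12)}<1-x\big(K_{\nu}(x)\mathbf{L}_{\nu-1}(x)+K_{\nu-1}(x)\mathbf{L}_{\nu}(x)\big)<\frac{x^{\nu}K_{\nu}(x)}{2^{\nu-1}\Gamma(\nu)}.$$ (ii) If $\nu>-\frac12$, then for all $x>0$, $$\frac{x^{\nu-1}I_{\nu+1}(x)}{\sqrt{\pi}\,2^{\nu-1}\Gamma(\nu+\frac12)}<I_{\nu}(x)\mathbf{L}_{\nu-1}(x)-I_{\nu-1}(x)\mathbf{L}_{\nu}(x)<\frac{x^{\nu-1}I_{\nu+1}(x)}{\sqrt{\pi}\,2^{\nu-1}\Gamma(\nu+\frac12)}\bigg\{1+\frac{1}{2\nu+1}\bigg(1-\frac{I_{\nu+3}(x)}{I_{\nu+1}(x)}\bigg)\bigg\}.$$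 -/

import Mathlib

open MeasureTheory

noncomputable section

/-- The modified Bessel function of the first kind,
`I_ν(x) = (x/2)^ν ∑_{k ≥ 0} (x²/4)^k / (k! Γ(ν + k + 1))`, for real order `ν` and `x > 0`.
Terms in which `ν + k + 1` is a nonpositive integer vanish, as in the usual convention `1/Γ = 0`
at the poles of `Γ` (Mathlib has `Real.Gamma (-n) = 0` and `a / 0 = 0`). -/
def besselI (ν x : ℝ) : ℝ :=
  (x / 2) ^ ν * ∑' k : ℕ, (x ^ 2 / 4) ^ k / ((k.factorial : ℝ) * Real.Gamma (ν + k + 1))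

/-- The modified Bessel function of the second kind (Macdonald function) for real order `ν` and
`x > 0`: `K_ν(x) = ∫_0^∞ exp(-x cosh t) cosh(ν t) dt`. -/
def besselK (ν x : ℝ) : ℝ :=
  ∫ t in Set.Ioi (0 : ℝ), Real.exp (-x * Real.cosh t) * Real.cosh (ν * t)

/-- The modified Struve function,
`𝐋_ν(x) = (x/2)^(ν+1) ∑_{k ≥ 0} (x/2)^(2k) / (Γ(k + 3/2) Γ(k + ν + 3/2))`, for `x > 0`. -/
def struveL (ν x : ℝ) : ℝ :=
  (x / 2) ^ (ν + 1) *
    ∑' k : ℕ, (x / 2) ^ (2 * k) / (Real.Gamma (k + 3 / 2) * Real.Gamma (k + ν + 3 / 2))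

end

section

open Real Filter Topology Set

/-! Write `c` for `struveConst ν`. The lowering relations for `I_ν`, `𝐋_ν` and the raising relations
for `I_{ν-1}`, `𝐋_{ν-1}` close up on the orders `ν - 1` and `ν`, apart from an inhomogeneous term `c
x^(ν-1)` in the Struve relation. Hence `F = x (I_ν 𝐋_{ν-1} - I_{ν-1} 𝐋_ν)` has derivative `c x^ν
I_ν`, and `G = 1 - x (K_ν 𝐋_{ν-1} + K_{ν-1} 𝐋_ν)` has derivative `-c x^ν K_ν`.

For (ii), `F` and both bounds (times `x`) vanish at `0`, so it suffices to compare derivatives.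

For (i), `G` tends to `1` at `0`, and to `0` at infinity because `∫₀^∞ t^ν K_ν = 1 / c`. The lower
bound compares derivatives backwards from infinity, using `K_{ν-1} < K_ν`. For the upper bound, the
difference of the two sides vanishes at both ends, and its derivative changes sign at most once,
from plus to minus, because `K_{ν-1} / K_ν` increases (`besselK_sub_one_mul_lt`). It is therefore
positive in between. -/

/-! ### Power series with two reciprocal Gamma factors -/

theorem div_Gamma_add_one (a : ℝ) : a / Gamma (a + 1) = 1 / Gamma a := by
  rcases eq_or_ne a 0 with rfl | h
  · simp
  · rw [Gamma_add_one h]; field_simp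

/-- The entire function `∑ y ^ k / (Γ(k + p + 1) Γ(k + q + 1))`. -/
noncomputable def gammaSeries (p q y : ℝ) : ℝ :=
  ∑' k : ℕ, y ^ k / (Gamma (k + p + 1) * Gamma (k + q + 1))

theorem summable_gammaSeries_abs (p q y : ℝ) :
    Summable fun k : ℕ => |y ^ k / (Gamma (k + p + 1) * Gamma (k + q + 1))| := by
  rw [summable_abs_iff]
  -- The ratio test needs eventually nonzero terms, so `y = 0` is separate. Poles of Gamma affect
  -- only finitely many `k`.
  rcases eq_or_ne y 0 with rfl | hy
  · refine summable_of_hasFiniteSupport ((Set.finite_singleton 0).subset fun k hk => ?_)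
    by_contra h
    exact hk (by simp [zero_pow (show k ≠ 0 from h)])
  have hp : ∀ r : ℝ, ∀ᶠ k : ℕ in atTop, 0 < (k : ℝ) + r + 1 := fun r => by
    filter_upwards [tendsto_natCast_atTop_atTop.eventually (eventually_gt_atTop (-r - 1))] with k hk
    linarith
  have hlim : ∀ r : ℝ, Tendsto (fun k : ℕ => ((k : ℝ) + r + 1)⁻¹) atTop (𝓝 0) := fun r => by
    have h : Tendsto (fun k : ℕ => (k : ℝ) + (r + 1)) atTop atTop :=
      tendsto_atTop_add_const_right _ _ tendsto_natCast_atTop_atTop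
    simp only [add_assoc]
    exact h.inv_tendsto_atTop
  refine summable_of_ratio_test_tendsto_lt_one (l := 0) zero_lt_one ?_ ?_
  · filter_upwards [hp p, hp q] with k h1 h2
    have := Gamma_pos_of_pos h1
    have := Gamma_pos_of_pos h2
    positivity
  · have h := (((hlim p).mul (hlim q)).const_mul y).norm
    simp only [mul_zero, norm_zero] at h
    refine h.congr' ?_
    filter_upwards [hp p, hp q] with k h1 h2
    have g1 := (Gamma_pos_of_pos h1).ne'
    have g2 := (Gamma_pos_of_pos h2).ne'
    rw [← norm_div]
    congr 1
    have e1 : ((k + 1 : ℕ) : ℝ) + p + 1 = (k + p + 1) + 1 := by push_cast; ring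
    have e2 : ((k + 1 : ℕ) : ℝ) + q + 1 = (k + q + 1) + 1 := by push_cast; ring
    rw [e1, e2, Gamma_add_one h1.ne', Gamma_add_one h2.ne', pow_succ]
    field_simp

theorem summable_gammaSeries (p q y : ℝ) :
    Summable fun k : ℕ => y ^ k / (Gamma (k + p + 1) * Gamma (k + q + 1)) :=
  (summable_gammaSeries_abs p q y).of_abs

/-- Since `k ≤ 2 ^ k`, the differentiated series is dominated by the original one at `2 (R + 1)`. -/
theorem summable_gammaSeries_deriv_bound (p q : ℝ) {R : ℝ} (hR : 0 ≤ R) :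
    Summable fun k : ℕ => |(k : ℝ) * R ^ (k - 1) / (Gamma (k + p + 1) * Gamma (k + q + 1))| := by
  refine Summable.of_nonneg_of_le (fun _ => abs_nonneg _) (fun k => ?_)
    (summable_gammaSeries_abs p q (2 * (R + 1)))
  rw [abs_div, abs_div]
  refine div_le_div_of_nonneg_right ?_ (abs_nonneg _)
  rw [abs_of_nonneg (by positivity), abs_of_nonneg (by positivity), mul_pow]
  have h1 : (k : ℝ) ≤ 2 ^ k := by exact_mod_cast Nat.lt_two_pow_self.le
  have h2 : R ^ (k - 1) ≤ (R + 1) ^ k :=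
    (pow_le_pow_left₀ hR (by linarith) _).trans
      (pow_le_pow_right₀ (by linarith) (Nat.sub_le _ _))
  gcongr

/-- The derivative of `gammaSeries p q`. -/
noncomputable def gammaSeriesDeriv (p q y : ℝ) : ℝ :=
  ∑' k : ℕ, (k : ℝ) * y ^ (k - 1) / (Gamma (k + p + 1) * Gamma (k + q + 1))

theorem hasDerivAt_gammaSeries (p q y : ℝ) :
    HasDerivAt (gammaSeries p q) (gammaSeriesDeriv p q y) y := by
  have hR : 0 ≤ |y| + 1 := by positivity
  refine hasDerivAt_tsum_of_isPreconnected (t := Metric.ball 0 (|y| + 1)) (y₀ := y)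
    (summable_gammaSeries_deriv_bound p q hR) Metric.isOpen_ball
    (convex_ball _ _).isPreconnected
    (fun n z _ => (hasDerivAt_pow n z).div_const _) (fun n z hz => ?_) (by simp)
    (summable_gammaSeries p q y) (by simp)
  rw [norm_eq_abs, abs_div, abs_div]
  refine div_le_div_of_nonneg_right ?_ (abs_nonneg _)
  rw [abs_mul, abs_mul, abs_pow, abs_pow, abs_of_nonneg hR]
  have : |z| ≤ |y| + 1 := by simpa using (mem_ball_zero_iff.1 hz).le
  gcongr

theorem summable_gammaSeriesDeriv (p q y : ℝ) :
    Summable fun k : ℕ => (k : ℝ) * y ^ (k - 1) / (Gamma (k + p + 1) * Gamma (k + q + 1)) := by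
  rw [← summable_abs_iff]
  refine (summable_gammaSeries_deriv_bound p q (abs_nonneg y)).congr fun k => ?_
  simp only [abs_div, abs_mul, abs_pow, abs_abs]

/-- Termwise this is `1 / Γ(k + q) = (k + q) / Γ(k + q + 1)`, with `k` produced by `y d/dy`. It
survives at the poles of Gamma, so `q` is unrestricted. -/
theorem gammaSeries_sub_one_right (p q y : ℝ) :
    gammaSeries p (q - 1) y = q * gammaSeries p q y + y * gammaSeriesDeriv p q y := by
  unfold gammaSeries gammaSeriesDeriv
  rw [← tsum_mul_left, ← tsum_mul_left, ← ((summable_gammaSeries p q y).mul_left q).tsum_add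
    ((summable_gammaSeriesDeriv p q y).mul_left y)]
  refine tsum_congr fun k => ?_
  have e : (k : ℝ) + (q - 1) + 1 = k + q := by ring
  have e2 : y * ((k : ℝ) * y ^ (k - 1)) = k * y ^ k := by
    rcases k with _ | k
    · simp
    · rw [Nat.add_sub_cancel, pow_succ]; ring
  rw [e, ← mul_div_assoc, ← mul_div_assoc, e2, ← add_div]
  have := div_Gamma_add_one (k + q)
  calc _ = y ^ k / Gamma (k + p + 1) * (1 / Gamma (k + q)) := by ring
    _ = _ := by rw [← this]; ring

theorem gammaSeries_comm (p q y : ℝ) : gammaSeries p q y = gammaSeries q p y := by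
  simp only [gammaSeries, mul_comm]

theorem gammaSeries_sub_one_left (p q y : ℝ) :
    gammaSeries (p - 1) q y = 1 / (Gamma p * Gamma (q + 1)) + y * gammaSeries p (q + 1) y := by
  unfold gammaSeries
  rw [(summable_gammaSeries (p - 1) q y).tsum_eq_zero_add, ← tsum_mul_left]
  congr 1
  · simp
  · refine tsum_congr fun k => ?_
    push_cast
    rw [show (k : ℝ) + 1 + (p - 1) + 1 = k + p + 1 by ring,
      show (k : ℝ) + 1 + q + 1 = k + (q + 1) + 1 by ring, pow_succ]
    ring

theorem gammaSeries_pos {p q y : ℝ} (hp : -1 < p) (hq : -1 < q) (hy : 0 ≤ y) :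
    0 < gammaSeries p q y := by
  have hG : ∀ r : ℝ, -1 < r → ∀ k : ℕ, 0 < Gamma (k + r + 1) := fun r hr k =>
    Gamma_pos_of_pos (by have : (0 : ℝ) ≤ k := k.cast_nonneg
                         linarith)
  refine (summable_gammaSeries p q y).tsum_pos (fun k => ?_) 0 ?_
  · have := hG p hp k
    have := hG q hq k
    positivity
  · have := hG p hp 0
    have := hG q hq 0
    simp only [pow_zero]
    positivity

/-! ### A common family for Bessel and Struve functions -/

/-- `(x / 2) ^ (p + q) ∑ (x² / 4) ^ k / (Γ(k + p + 1) Γ(k + q + 1))`, which contains both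
the modified Bessel function (`p = 0`) and the modified Struve function (`p = 1 / 2`). -/
noncomputable def besselStruve (p q x : ℝ) : ℝ :=
  (x / 2) ^ (p + q) * gammaSeries p q (x ^ 2 / 4)

theorem besselStruve_comm (p q x : ℝ) : besselStruve p q x = besselStruve q p x := by
  rw [besselStruve, besselStruve, gammaSeries_comm, add_comm]

theorem besselI_eq (ν x : ℝ) : besselI ν x = besselStruve 0 ν x := by
  unfold besselI besselStruve gammaSeries
  rw [zero_add]
  congr 1
  refine tsum_congr fun k => ?_
  rw [add_zero, Gamma_nat_eq_factorial, add_comm ν]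

theorem struveL_eq (ν x : ℝ) : struveL ν x = besselStruve (1 / 2) (ν + 1 / 2) x := by
  unfold struveL besselStruve gammaSeries
  rw [show 1 / 2 + (ν + 1 / 2) = ν + 1 by ring]
  congr 1
  refine tsum_congr fun k => ?_
  rw [pow_mul, show (x / 2) ^ 2 = x ^ 2 / 4 by ring,
    show (k : ℝ) + 1 / 2 + 1 = k + 3 / 2 by ring,
    show (k : ℝ) + (ν + 1 / 2) + 1 = k + ν + 3 / 2 by ring]

theorem hasDerivAt_besselStruve (p q : ℝ) {x : ℝ} (hx : 0 < x) :
    HasDerivAt (besselStruve p q)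
      (besselStruve p (q - 1) x + (p - q) / x * besselStruve p q x) x := by
  have h1 : HasDerivAt (fun x : ℝ => (x / 2) ^ (p + q))
      (1 / 2 * (p + q) * (x / 2) ^ (p + q - 1)) x :=
    ((hasDerivAt_id x).div_const 2).rpow_const (Or.inl (by simp; positivity))
  have h2 : HasDerivAt (fun x : ℝ => x ^ 2 / 4) (x / 2) x := by
    convert! (hasDerivAt_pow 2 x).div_const 4 using 1
    simp; ring
  have h3 := (hasDerivAt_gammaSeries p q (x ^ 2 / 4)).comp x h2
  convert! h1.mul h3 using 1
  unfold besselStruve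
  rw [gammaSeries_sub_one_right, show p + (q - 1) = p + q - 1 by ring]
  have hx2 : x / 2 ≠ 0 := by positivity
  rw [show (x / 2) ^ (p + q) = (x / 2) ^ (p + q - 1) * (x / 2) by
    rw [← rpow_add_one hx2]; ring_nf]
  simp only [Function.comp]
  field_simp
  ring

/-- By symmetry the lowering relation may act on `p`; an index shift then raises `q` and splits off
the term `k = 0`. That term vanishes for `p = 0` (Bessel) and is the inhomogeneity for `p = 1 / 2`
(Struve). -/
theorem hasDerivAt_besselStruve' (p q : ℝ) {x : ℝ} (hx : 0 < x) :
    HasDerivAt (besselStruve p q)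
      ((x / 2) ^ (p + q - 1) / (Gamma p * Gamma (q + 1)) + besselStruve p (q + 1) x
        + (q - p) / x * besselStruve p q x) x := by
  have h := hasDerivAt_besselStruve q p hx
  rw [show besselStruve q p = besselStruve p q from funext fun x => besselStruve_comm q p x,
    besselStruve_comm q (p - 1)] at h
  convert! h using 2
  unfold besselStruve
  have hx2 : x / 2 ≠ 0 := by positivity
  rw [gammaSeries_sub_one_left, show p - 1 + q = p + q - 1 by ring,
    show p + (q + 1) = p + q - 1 + 2 by ring, rpow_add (by positivity)]
  simp
  ring

theorem besselStruve_pos {p q x : ℝ} (hp : -1 < p) (hq : -1 < q) (hx : 0 < x) :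
    0 < besselStruve p q x :=
  mul_pos (by positivity) (gammaSeries_pos hp hq (by positivity))

theorem tendsto_gammaSeries_sq (p q : ℝ) :
    Tendsto (fun x : ℝ => gammaSeries p q (x ^ 2 / 4)) (𝓝[>] 0) (𝓝 (gammaSeries p q 0)) := by
  have h : Continuous fun x : ℝ => gammaSeries p q (x ^ 2 / 4) :=
    (continuous_iff_continuousAt.2 fun y => (hasDerivAt_gammaSeries p q y).continuousAt).comp
      (by fun_prop)
  simpa using (h.tendsto 0).mono_left nhdsWithin_le_nhds

theorem tendsto_rpow_nhdsGT_zero {a : ℝ} (ha : 0 < a) :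
    Tendsto (fun x : ℝ => x ^ a) (𝓝[>] 0) (𝓝 0) := by
  have h := (continuousAt_rpow_const 0 a (Or.inr ha.le)).tendsto
  rw [zero_rpow ha.ne'] at h
  exact h.mono_left nhdsWithin_le_nhds

theorem tendsto_rpow_mul_besselStruve {a p q : ℝ} (h : 0 < a + (p + q)) :
    Tendsto (fun x : ℝ => x ^ a * besselStruve p q x) (𝓝[>] 0) (𝓝 0) := by
  have h1 := ((tendsto_rpow_nhdsGT_zero h).div_const (2 ^ (p + q))).mul
    (tendsto_gammaSeries_sq p q)
  simp only [zero_div, zero_mul] at h1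
  refine h1.congr' ?_
  filter_upwards [self_mem_nhdsWithin] with x (hx : 0 < x)
  unfold besselStruve
  rw [div_rpow hx.le (by norm_num), rpow_add hx]
  ring

/-! ### Differential recurrences for `I_ν` and `𝐋_ν` -/

theorem besselI_pos {ν x : ℝ} (hν : -1 < ν) (hx : 0 < x) : 0 < besselI ν x := by
  rw [besselI_eq]; exact besselStruve_pos (by norm_num) hν hx

theorem hasDerivAt_besselI (ν : ℝ) {x : ℝ} (hx : 0 < x) :
    HasDerivAt (besselI ν) (besselI (ν - 1) x - ν / x * besselI ν x) x := by
  rw [funext (besselI_eq ν), besselI_eq]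
  convert! hasDerivAt_besselStruve 0 ν hx using 1
  ring

theorem hasDerivAt_besselI' (ν : ℝ) {x : ℝ} (hx : 0 < x) :
    HasDerivAt (besselI ν) (besselI (ν + 1) x + ν / x * besselI ν x) x := by
  rw [funext (besselI_eq ν), besselI_eq]
  convert! hasDerivAt_besselStruve' 0 ν hx using 1
  simp

theorem besselI_sub_besselI (ν : ℝ) {x : ℝ} (hx : 0 < x) :
    besselI (ν - 1) x - besselI (ν + 1) x = 2 * ν / x * besselI ν x := by
  have := (hasDerivAt_besselI ν hx).unique (hasDerivAt_besselI' ν hx)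
  linear_combination this

theorem hasDerivAt_struveL (ν : ℝ) {x : ℝ} (hx : 0 < x) :
    HasDerivAt (struveL ν) (struveL (ν - 1) x - ν / x * struveL ν x) x := by
  rw [funext (struveL_eq ν), struveL_eq]
  convert! hasDerivAt_besselStruve (1 / 2) (ν + 1 / 2) hx using 1
  ring_nf

theorem hasDerivAt_struveL' (ν : ℝ) {x : ℝ} (hx : 0 < x) :
    HasDerivAt (struveL ν) ((x / 2) ^ ν / (√π * Gamma (ν + 3 / 2)) + struveL (ν + 1) x
      + ν / x * struveL ν x) x := by
  rw [funext (struveL_eq ν), struveL_eq]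
  convert! hasDerivAt_besselStruve' (1 / 2) (ν + 1 / 2) hx using 1
  rw [Gamma_one_half_eq]
  ring_nf

theorem tendsto_rpow_mul_besselI {a ν : ℝ} (h : 0 < a + ν) :
    Tendsto (fun x : ℝ => x ^ a * besselI ν x) (𝓝[>] 0) (𝓝 0) := by
  rw [funext (besselI_eq ν)]
  exact tendsto_rpow_mul_besselStruve (by linarith)

theorem tendsto_rpow_mul_struveL {a ν : ℝ} (h : 0 < a + (ν + 1)) :
    Tendsto (fun x : ℝ => x ^ a * struveL ν x) (𝓝[>] 0) (𝓝 0) := by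
  rw [funext (struveL_eq ν)]
  exact tendsto_rpow_mul_besselStruve (by linarith)

/-! ### The `I`–`𝐋` combination and the bounds of (ii) -/

/-- The constant `1 / (√π 2 ^ (ν - 1) Γ(ν + 1 / 2))`. -/
noncomputable def struveConst (ν : ℝ) : ℝ := 1 / (√π * 2 ^ (ν - 1) * Gamma (ν + 1 / 2))

theorem struveConst_pos {ν : ℝ} (hν : -(1 / 2) < ν) : 0 < struveConst ν := by
  have := Gamma_pos_of_pos (show 0 < ν + 1 / 2 by linarith)
  have := pi_pos
  unfold struveConst; positivity

theorem hasDerivAt_struveL_sub_one (ν : ℝ) {x : ℝ} (hx : 0 < x) :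
    HasDerivAt (struveL (ν - 1)) (struveConst ν * x ^ (ν - 1) + struveL ν x
      + (ν - 1) / x * struveL (ν - 1) x) x := by
  convert! hasDerivAt_struveL' (ν - 1) hx using 3
  · rw [div_rpow hx.le (by norm_num), struveConst, show ν - 1 + 3 / 2 = ν + 1 / 2 by ring]
    rw [div_div, one_div_mul_eq_div]
    ring
  · ring_nf

theorem hasDerivAt_besselI_struveL (ν : ℝ) {x : ℝ} (hx : 0 < x) :
    HasDerivAt (fun x => x * (besselI ν x * struveL (ν - 1) x - besselI (ν - 1) x * struveL ν x))
      (struveConst ν * (x ^ ν * besselI ν x)) x := by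
  have hI := hasDerivAt_besselI' (ν - 1) hx
  rw [sub_add_cancel] at hI
  convert! (hasDerivAt_id x).mul (((hasDerivAt_besselI ν hx).mul
    (hasDerivAt_struveL_sub_one ν hx)).sub (hI.mul (hasDerivAt_struveL ν hx))) using 1
  rw [show x ^ ν = x ^ (ν - 1) * x by rw [← rpow_add_one hx.ne']; ring_nf]
  simp only [id, Pi.sub_apply, Pi.mul_apply]
  field_simp
  ring

theorem tendsto_besselI_struveL {ν : ℝ} (hν : -(1 / 2) < ν) :
    Tendsto (fun x => x * (besselI ν x * struveL (ν - 1) x - besselI (ν - 1) x * struveL ν x))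
      (𝓝[>] 0) (𝓝 0) := by
  -- The factor `x` is split so that each of the four factors behaves like `x ^ (ν + 1 / 2)`.
  have h := ((tendsto_rpow_mul_besselI (a := 1 / 2) (ν := ν) (by linarith)).mul
    (tendsto_rpow_mul_struveL (a := 1 / 2) (ν := ν - 1) (by linarith))).sub
    ((tendsto_rpow_mul_besselI (a := 3 / 2) (ν := ν - 1) (by linarith)).mul
    (tendsto_rpow_mul_struveL (a := -(1 / 2)) (ν := ν) (by linarith)))
  simp only [mul_zero, sub_zero] at h
  refine h.congr' ?_
  filter_upwards [self_mem_nhdsWithin] with x (hx : 0 < x)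
  have e1 : x ^ (1 / 2 : ℝ) * x ^ (1 / 2 : ℝ) = x := by rw [← rpow_add hx]; norm_num
  have e2 : x ^ (3 / 2 : ℝ) * x ^ (-(1 / 2) : ℝ) = x := by rw [← rpow_add hx]; norm_num
  linear_combination (besselI ν x * struveL (ν - 1) x) * e1
    - (besselI (ν - 1) x * struveL ν x) * e2

/-- A function on `(0, ∞)` with positive derivative lies above its limit at `0`. -/
theorem lt_of_tendsto_nhdsGT_of_hasDerivAt_pos {f f' : ℝ → ℝ} {l x : ℝ} (hx : 0 < x)
    (hf : ∀ y, 0 < y → y ≤ x → HasDerivAt f (f' y) y) (hf' : ∀ y, 0 < y → y < x → 0 < f' y)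
    (hl : Tendsto f (𝓝[>] 0) (𝓝 l)) : l < f x := by
  have hm : StrictMonoOn f (Ioc 0 x) := by
    refine strictMonoOn_of_deriv_pos (convex_Ioc 0 x)
      (fun y hy => (hf y hy.1 hy.2).continuousAt.continuousWithinAt) fun y hy => ?_
    rw [interior_Ioc] at hy
    rw [(hf y hy.1 hy.2.le).deriv]
    exact hf' y hy.1 hy.2
  have h2 : f (x / 2) < f x := hm ⟨by linarith, by linarith⟩ ⟨hx, le_rfl⟩ (by linarith)
  refine lt_of_le_of_lt (le_of_tendsto hl ?_) h2
  filter_upwards [Ioo_mem_nhdsGT (show (0 : ℝ) < x / 2 by linarith)] with y hy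
  exact (hm ⟨hy.1, by linarith [hy.2]⟩ ⟨by linarith, by linarith⟩ hy.2).le

theorem lt_of_tendsto_nhdsGT_of_hasDerivAt_lt {f g f' g' : ℝ → ℝ} {l x : ℝ} (hx : 0 < x)
    (hf : ∀ y, 0 < y → HasDerivAt f (f' y) y) (hg : ∀ y, 0 < y → HasDerivAt g (g' y) y)
    (hfg : ∀ y, 0 < y → y < x → f' y < g' y)
    (hfl : Tendsto f (𝓝[>] 0) (𝓝 l)) (hgl : Tendsto g (𝓝[>] 0) (𝓝 l)) : f x < g x := by
  have h := hgl.sub hfl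
  rw [sub_self] at h
  exact sub_pos.1 (lt_of_tendsto_nhdsGT_of_hasDerivAt_pos (f := fun y => g y - f y)
    (f' := fun y => g' y - f' y) hx (fun y hy _ => (hg y hy).sub (hf y hy))
    (fun y hy hy' => sub_pos.2 (hfg y hy hy')) h)

theorem hasDerivAt_rpow_mul_besselI (ν μ : ℝ) {x : ℝ} (hx : 0 < x) :
    HasDerivAt (fun x => x ^ ν * besselI μ x)
      (x ^ ν * (besselI (μ - 1) x + (ν - μ) / x * besselI μ x)) x := by
  convert! (hasDerivAt_rpow_const (p := ν) (Or.inl hx.ne')).mul (hasDerivAt_besselI μ hx) using 1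
  rw [show x ^ ν = x ^ (ν - 1) * x by rw [← rpow_add_one hx.ne']; ring_nf]
  field_simp
  ring

/-- The derivative of `x^ν I_{ν+1}` falls short of `x^ν I_ν` by `x^(ν-1) I_{ν+1} > 0`. -/
theorem rpow_mul_besselI_lt {ν x : ℝ} (hν : -(1 / 2) < ν) (hx : 0 < x) :
    struveConst ν * (x ^ ν * besselI (ν + 1) x) <
      x * (besselI ν x * struveL (ν - 1) x - besselI (ν - 1) x * struveL ν x) := by
  have hlim := (tendsto_rpow_mul_besselI (a := ν) (ν := ν + 1) (by linarith)).const_mul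
    (struveConst ν)
  rw [mul_zero] at hlim
  refine lt_of_tendsto_nhdsGT_of_hasDerivAt_lt (l := 0)
    (f := fun x => struveConst ν * (x ^ ν * besselI (ν + 1) x))
    (g := fun x => x * (besselI ν x * struveL (ν - 1) x - besselI (ν - 1) x * struveL ν x)) hx
    (fun y hy => (hasDerivAt_rpow_mul_besselI ν (ν + 1) hy).const_mul (struveConst ν))
    (fun y hy => hasDerivAt_besselI_struveL ν hy) (fun y hy _ => sub_pos.1 ?_)
    hlim (tendsto_besselI_struveL hν)
  have h1 := struveConst_pos hν
  have h2 := besselI_pos (show -1 < ν + 1 by linarith) hy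
  have h3 : 0 < struveConst ν * (y ^ ν * (besselI (ν + 1) y / y)) := by positivity
  rw [add_sub_cancel_right]
  refine h3.trans_eq ?_
  ring

/-- The coefficients are chosen so that the three-term recurrence cancels the `I_{ν+1}` terms,
leaving a derivative surplus proportional to `x^(ν-1) I_{ν+3}`. -/
theorem lt_rpow_mul_besselI {ν x : ℝ} (hν : -(1 / 2) < ν) (hx : 0 < x) :
    x * (besselI ν x * struveL (ν - 1) x - besselI (ν - 1) x * struveL ν x) <
      struveConst ν * (2 * (ν + 1) / (2 * ν + 1) * (x ^ ν * besselI (ν + 1) x)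
        - 1 / (2 * ν + 1) * (x ^ ν * besselI (ν + 3) x)) := by
  have hlim := (((tendsto_rpow_mul_besselI (a := ν) (ν := ν + 1) (by linarith)).const_mul
    (2 * (ν + 1) / (2 * ν + 1))).sub
    ((tendsto_rpow_mul_besselI (a := ν) (ν := ν + 3) (by linarith)).const_mul
    (1 / (2 * ν + 1)))).const_mul (struveConst ν)
  simp only [mul_zero, sub_zero] at hlim
  refine lt_of_tendsto_nhdsGT_of_hasDerivAt_lt
    (f := fun x => x * (besselI ν x * struveL (ν - 1) x - besselI (ν - 1) x * struveL ν x))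
    (g := fun x => struveConst ν * (2 * (ν + 1) / (2 * ν + 1) * (x ^ ν * besselI (ν + 1) x)
        - 1 / (2 * ν + 1) * (x ^ ν * besselI (ν + 3) x))) hx
    (fun y hy => hasDerivAt_besselI_struveL ν hy)
    (fun y hy => (((hasDerivAt_rpow_mul_besselI ν (ν + 1) hy).const_mul _).sub
      ((hasDerivAt_rpow_mul_besselI ν (ν + 3) hy).const_mul _)).const_mul (struveConst ν))
    (fun y hy _ => sub_pos.1 ?_) (tendsto_besselI_struveL hν) hlim
  have h1 := struveConst_pos hν
  have h2 := besselI_pos (show -1 < ν + 3 by linarith) hy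
  have hν' : 0 < 2 * ν + 1 := by linarith
  have h3 : 0 < struveConst ν * (y ^ ν * (3 / (2 * ν + 1) * (besselI (ν + 3) y / y))) := by
    positivity
  have hrec := besselI_sub_besselI (ν + 1) hy
  rw [add_sub_cancel_right, show ν + 1 + 1 = ν + 2 by ring] at hrec
  rw [add_sub_cancel_right, show ν + 3 - 1 = ν + 2 by ring]
  refine h3.trans_eq ?_
  have hrec' : besselI ν y = besselI (ν + 2) y + 2 * (ν + 1) / y * besselI (ν + 1) y := by
    linarith
  rw [hrec']
  field_simp
  ring

/-! ### `K_ν` as a Gamma-type integral -/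

theorem setIntegral_Ioi_pos {f : ℝ → ℝ} (hf : IntegrableOn f (Ioi 0)) (t₀ : ℝ)
    (h₀ : ∀ t, 0 < t → 0 ≤ f t) (h : ∀ t, 0 < t → t ≠ t₀ → 0 < f t) :
    0 < ∫ t in Ioi (0 : ℝ), f t := by
  rw [setIntegral_pos_iff_support_of_nonneg_ae
    ((ae_restrict_iff' measurableSet_Ioi).2 (ae_of_all _ h₀)) hf]
  have hsub : Ioi (max 0 t₀) ⊆ Function.support f ∩ Ioi 0 := fun t ht => by
    have ht : max 0 t₀ < t := ht
    have h1 := (le_max_left 0 t₀).trans_lt ht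
    exact ⟨(h t h1 ((le_max_right 0 t₀).trans_lt ht).ne').ne', h1⟩
  exact lt_of_lt_of_le (by simp) (measure_mono hsub)

theorem integrableOn_rpow_mul_exp_neg {p : ℝ} (hp : -1 < p) :
    IntegrableOn (fun s : ℝ => s ^ p * exp (-s)) (Ioi 0) := by
  refine (GammaIntegral_convergent (show 0 < p + 1 by linarith)).congr_fun (fun s _ => ?_)
    measurableSet_Ioi
  simp only [add_sub_cancel_right, mul_comm]

theorem measurable_rpow_mul_exp_neg_sub_div (p b : ℝ) :
    Measurable fun s : ℝ => s ^ p * exp (-s - b / s) := by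
  fun_prop

theorem integrableOn_rpow_mul_exp_neg_sub_div (p : ℝ) {b : ℝ} (hb : 0 < b) :
    IntegrableOn (fun s : ℝ => s ^ p * exp (-s - b / s)) (Ioi 0) := by
  -- The bound `exp(-b/s) ≤ n! (s/b)^n` turns the exponent `p` into `p + n > -1`, which is
  -- integrable at `0`.
  obtain ⟨n, hn⟩ := exists_nat_gt (-1 - p)
  refine ((integrableOn_rpow_mul_exp_neg (show -1 < p + n by linarith)).const_mul
    (n.factorial / b ^ n)).mono' (measurable_rpow_mul_exp_neg_sub_div p b).aestronglyMeasurable ?_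
  refine (ae_restrict_iff' measurableSet_Ioi).2 (ae_of_all _ fun s (hs : 0 < s) => ?_)
  have h1 : exp (-(b / s)) ≤ n.factorial / b ^ n * s ^ n := by
    have h2 := pow_div_factorial_le_exp (b / s) (by positivity) n
    rw [exp_neg]
    refine (inv_anti₀ (by positivity) h2).trans_eq ?_
    rw [div_pow]
    field_simp
  rw [norm_of_nonneg (by positivity), sub_eq_add_neg, exp_add, rpow_add hs, rpow_natCast]
  calc s ^ p * (exp (-s) * exp (-(b / s)))
      ≤ s ^ p * (exp (-s) * (n.factorial / b ^ n * s ^ n)) := by gcongr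
    _ = _ := by ring

/-- `∫₀^∞ s ^ (ν - 1) exp(-s - x² / (4 s)) ds`, which is `x ^ ν K_ν(x)` up to a constant. -/
noncomputable def gammaKernelIntegral (ν x : ℝ) : ℝ :=
  ∫ s in Ioi (0 : ℝ), s ^ (ν - 1) * exp (-s - x ^ 2 / 4 / s)

/-- The substitution `t = log (2 s / x)` carries `(0, ∞)` onto the line and turns `x cosh t` into `s
+ x² / (4 s)`. -/
theorem image_log_add (a : ℝ) : (fun s : ℝ => log s + a) '' Ioi 0 = univ := by
  refine eq_univ_of_forall fun t => ⟨exp (t - a), exp_pos _, ?_⟩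
  simp

theorem injOn_log_add (a : ℝ) : InjOn (fun s : ℝ => log s + a) (Ioi 0) :=
  fun _ hs _ ht h => log_injOn_pos hs ht (add_right_cancel h)

theorem hasDerivWithinAt_log_add (a : ℝ) :
    ∀ s ∈ Ioi (0 : ℝ), HasDerivWithinAt (fun s : ℝ => log s + a) s⁻¹ (Ioi 0) s :=
  fun _ hs => ((hasDerivAt_log (ne_of_gt hs)).add_const a).hasDerivWithinAt

theorem abs_inv_smul_exp_log_add (ν : ℝ) {x s : ℝ} (hx : 0 < x) (hs : 0 < s) :
    |s⁻¹| • exp (-x * cosh (log s + log (2 / x)) + ν * (log s + log (2 / x))) =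
      (2 / x) ^ ν * (s ^ (ν - 1) * exp (-s - x ^ 2 / 4 / s)) := by
  have h2 : 0 < 2 / x := by positivity
  rw [← log_mul hs.ne' h2.ne', cosh_log (by positivity), exp_add, mul_comm ν,
    ← rpow_def_of_pos (by positivity), mul_rpow hs.le h2.le, abs_of_pos (by positivity), smul_eq_mul,
    rpow_sub_one hs.ne']
  rw [show -x * ((s * (2 / x) + (s * (2 / x))⁻¹) / 2) = -s - x ^ 2 / 4 / s by field_simp; ring]
  ring

theorem integrable_exp_cosh (ν : ℝ) {x : ℝ} (hx : 0 < x) :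
    Integrable fun t : ℝ => exp (-x * cosh t + ν * t) := by
  rw [← integrableOn_univ, ← image_log_add (log (2 / x)),
    integrableOn_image_iff_integrableOn_abs_deriv_smul measurableSet_Ioi
      (hasDerivWithinAt_log_add _) (injOn_log_add _)]
  refine IntegrableOn.congr_fun ((integrableOn_rpow_mul_exp_neg_sub_div (ν - 1)
    (show 0 < x ^ 2 / 4 by positivity)).const_mul ((2 / x) ^ ν)) (fun s hs => ?_) measurableSet_Ioi
  exact (abs_inv_smul_exp_log_add ν hx hs).symm

theorem integral_exp_cosh (ν : ℝ) {x : ℝ} (hx : 0 < x) :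
    ∫ t : ℝ, exp (-x * cosh t + ν * t) = (2 / x) ^ ν * gammaKernelIntegral ν x := by
  rw [← setIntegral_univ, ← image_log_add (log (2 / x)),
    integral_image_eq_integral_abs_deriv_smul measurableSet_Ioi
      (hasDerivWithinAt_log_add _) (injOn_log_add _), gammaKernelIntegral, ← integral_const_mul]
  exact setIntegral_congr_fun measurableSet_Ioi fun s hs => abs_inv_smul_exp_log_add ν hx hs

theorem exp_mul_cosh_eq (ν x t : ℝ) : exp (-x * cosh t) * cosh (ν * t) =
    (exp (-x * cosh t + ν * t) + exp (-x * cosh t + -ν * t)) / 2 := by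
  rw [cosh_eq (ν * t), exp_add, exp_add, neg_mul ν]; ring

theorem integrable_besselK (ν : ℝ) {x : ℝ} (hx : 0 < x) :
    Integrable fun t : ℝ => exp (-x * cosh t) * cosh (ν * t) := by
  simp only [exp_mul_cosh_eq]
  exact ((integrable_exp_cosh ν hx).add (integrable_exp_cosh (-ν) hx)).div_const 2

theorem rpow_mul_besselK (ν : ℝ) {x : ℝ} (hx : 0 < x) :
    x ^ ν * besselK ν x = 2 ^ (ν - 1) * gammaKernelIntegral ν x := by
  have h1 : ∫ t : ℝ, exp (-x * cosh t) * cosh (ν * t) = 2 * besselK ν x := by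
    have := integral_comp_abs (f := fun t : ℝ => exp (-x * cosh t) * cosh (ν * t))
    rw [besselK, ← this]
    refine integral_congr_ae (ae_of_all _ fun t => ?_)
    rcases abs_choice t with h | h <;> simp [h]
  have h2 : ∫ t : ℝ, exp (-x * cosh t + -ν * t) = ∫ t : ℝ, exp (-x * cosh t + ν * t) := by
    rw [← integral_neg_eq_self]; simp
  have h3 : ∫ t : ℝ, exp (-x * cosh t) * cosh (ν * t) =
      (2 / x) ^ ν * gammaKernelIntegral ν x := by
    simp only [exp_mul_cosh_eq]
    rw [integral_div, integral_add (integrable_exp_cosh ν hx) (integrable_exp_cosh (-ν) hx), h2,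
      integral_exp_cosh ν hx]
    ring
  have h4 : besselK ν x = (2 / x) ^ ν * gammaKernelIntegral ν x / 2 := by linarith
  rw [h4, div_rpow (by norm_num) hx.le, rpow_sub_one (by norm_num)]
  have := rpow_pos_of_pos hx ν
  field_simp

theorem hasDerivAt_gammaKernelIntegral (ν : ℝ) {x : ℝ} (hx : 0 < x) :
    HasDerivAt (gammaKernelIntegral ν) (-(x / 2) * gammaKernelIntegral (ν - 1) x) x := by
  have h := hasDerivAt_integral_of_dominated_loc_of_deriv_le (μ := volume.restrict (Ioi (0 : ℝ)))
    (F := fun x s => s ^ (ν - 1) * exp (-s - x ^ 2 / 4 / s))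
    (F' := fun x s => -(x / 2) * (s ^ (ν - 1 - 1) * exp (-s - x ^ 2 / 4 / s)))
    -- For `y` in this interval `y / 2 ≤ x`, and the exponential is at most its value at `x / 2`.
    (x₀ := x) (s := Ioo (x / 2) (2 * x))
    (bound := fun s => x * (s ^ (ν - 1 - 1) * exp (-s - (x / 2) ^ 2 / 4 / s)))
    (Ioo_mem_nhds (by linarith) (by linarith))
    (Eventually.of_forall fun y =>
      (measurable_rpow_mul_exp_neg_sub_div (ν - 1) (y ^ 2 / 4)).aestronglyMeasurable)
    (integrableOn_rpow_mul_exp_neg_sub_div (ν - 1) (by positivity))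
    ((measurable_rpow_mul_exp_neg_sub_div (ν - 1 - 1) (x ^ 2 / 4)).const_mul
      _).aestronglyMeasurable
    ?_ ((integrableOn_rpow_mul_exp_neg_sub_div (ν - 1 - 1) (by positivity)).const_mul x) ?_
  · convert! h.2 using 1
    rw [gammaKernelIntegral, ← integral_const_mul]
  · refine (ae_restrict_iff' measurableSet_Ioi).2 (ae_of_all _ fun s (hs : 0 < s) y hy => ?_)
    have hy1 : x / 2 < y := hy.1
    have hy0 : 0 < y := by linarith
    rw [norm_mul, norm_neg, norm_of_nonneg (by positivity), norm_of_nonneg (by positivity)]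
    have : y / 2 ≤ x := by linarith [hy.2]
    gcongr
  · refine (ae_restrict_iff' measurableSet_Ioi).2 (ae_of_all _ fun s (hs : 0 < s) y hy => ?_)
    have h1 : HasDerivAt (fun y : ℝ => -s - y ^ 2 / 4 / s) (-(y / 2 / s)) y := by
      convert! (((hasDerivAt_pow 2 y).div_const 4).div_const s).const_sub (-s) using 1
      simp; ring
    convert! h1.exp.const_mul (s ^ (ν - 1)) using 1
    rw [rpow_sub_one hs.ne' (ν - 1)]
    field_simp

/-! ### Recurrences, comparison and limits for `K_ν` -/

theorem besselK_neg (ν x : ℝ) : besselK (-ν) x = besselK ν x := by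
  simp [besselK]

theorem hasDerivAt_rpow_mul_besselK (ν : ℝ) {x : ℝ} (hx : 0 < x) :
    HasDerivAt (fun x => x ^ ν * besselK ν x) (-(x ^ ν * besselK (ν - 1) x)) x := by
  refine HasDerivAt.congr_of_eventuallyEq (f := fun x => 2 ^ (ν - 1) * gammaKernelIntegral ν x) ?_ ?_
  · convert! (hasDerivAt_gammaKernelIntegral ν hx).const_mul (2 ^ (ν - 1)) using 1
    have h := rpow_mul_besselK (ν - 1) hx
    rw [rpow_sub_one two_ne_zero, rpow_sub_one hx.ne', div_mul_eq_mul_div,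
      div_eq_iff hx.ne'] at h
    rw [h]
    ring
  · filter_upwards [lt_mem_nhds hx] with y hy using rpow_mul_besselK ν hy

theorem hasDerivAt_besselK (ν : ℝ) {x : ℝ} (hx : 0 < x) :
    HasDerivAt (besselK ν) (-besselK (ν - 1) x - ν / x * besselK ν x) x := by
  refine HasDerivAt.congr_of_eventuallyEq (f := fun x => x ^ (-ν) * (x ^ ν * besselK ν x)) ?_ ?_
  · convert! (hasDerivAt_rpow_const (p := -ν) (Or.inl hx.ne')).mul
      (hasDerivAt_rpow_mul_besselK ν hx) using 1
    have h : x ^ (-ν) * x ^ ν = 1 := by rw [← rpow_add hx]; simp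
    rw [rpow_sub_one hx.ne']
    linear_combination (-besselK (ν - 1) x - ν / x * besselK ν x) * (-h)
  · filter_upwards [lt_mem_nhds hx] with y hy
    rw [← mul_assoc, ← rpow_add hy]
    simp

theorem hasDerivAt_besselK' (ν : ℝ) {x : ℝ} (hx : 0 < x) :
    HasDerivAt (besselK ν) (-besselK (ν + 1) x + ν / x * besselK ν x) x := by
  have h := hasDerivAt_besselK (-ν) hx
  rw [funext (besselK_neg ν), show -ν - 1 = -(ν + 1) by ring, besselK_neg] at h
  convert! h using 1
  ring

theorem besselK_pos (ν : ℝ) {x : ℝ} (hx : 0 < x) : 0 < besselK ν x :=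
  setIntegral_Ioi_pos (integrable_besselK ν hx).integrableOn 0
    (fun _ _ => by positivity) fun _ _ _ => by positivity

/-- The integrands compare pointwise, since `|ν - 1| < ν` when `ν > 1 / 2`. -/
theorem besselK_sub_one_lt {ν x : ℝ} (hν : 1 / 2 < ν) (hx : 0 < x) :
    besselK (ν - 1) x < besselK ν x := by
  have h : ∀ t, 0 < t → 0 < exp (-x * cosh t) * cosh (ν * t) -
      exp (-x * cosh t) * cosh ((ν - 1) * t) := fun t ht => by
    rw [← mul_sub]
    refine mul_pos (exp_pos _) (sub_pos.2 (cosh_lt_cosh.2 ?_))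
    rw [abs_mul, abs_mul]
    refine mul_lt_mul_of_pos_right ?_ (abs_pos.2 ht.ne')
    rw [abs_of_pos (show 0 < ν by linarith), abs_lt]
    constructor <;> linarith
  have h1 := (integrable_besselK ν hx).integrableOn (s := Ioi 0)
  have h2 := (integrable_besselK (ν - 1) hx).integrableOn (s := Ioi 0)
  have h3 := setIntegral_Ioi_pos (h1.sub h2) 0 (fun t ht => (h t ht).le) fun t ht _ => h t ht
  simp only [Pi.sub_apply] at h3
  rw [integral_sub h1 h2] at h3
  exact sub_pos.1 h3

/-- The majorant `s^(ν-1) e^(-s)` is independent of `x`, so one argument serves both ends. -/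
theorem tendsto_gammaKernelIntegral {ν : ℝ} (hν : 0 < ν) {l : Filter ℝ} [l.IsCountablyGenerated]
    {g : ℝ → ℝ} (h : ∀ s, 0 < s → Tendsto (fun x : ℝ => s ^ (ν - 1) * exp (-s - x ^ 2 / 4 / s)) l
      (𝓝 (g s))) :
    Tendsto (gammaKernelIntegral ν) l (𝓝 (∫ s in Ioi (0 : ℝ), g s)) := by
  refine tendsto_integral_filter_of_dominated_convergence (fun s => s ^ (ν - 1) * exp (-s))
    (Eventually.of_forall fun x =>
      (measurable_rpow_mul_exp_neg_sub_div (ν - 1) (x ^ 2 / 4)).aestronglyMeasurable)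
    (Eventually.of_forall fun x => ?_) (integrableOn_rpow_mul_exp_neg (by linarith)) ?_
  · refine (ae_restrict_iff' measurableSet_Ioi).2 (ae_of_all _ fun s (hs : 0 < s) => ?_)
    rw [norm_of_nonneg (by positivity)]
    have : 0 ≤ x ^ 2 / 4 / s := by positivity
    gcongr
    linarith
  · exact (ae_restrict_iff' measurableSet_Ioi).2 (ae_of_all _ fun s hs => h s hs)

theorem tendsto_rpow_mul_besselK_zero {ν : ℝ} (hν : 0 < ν) :
    Tendsto (fun x => x ^ ν * besselK ν x) (𝓝[>] 0) (𝓝 (2 ^ (ν - 1) * Gamma ν)) := by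
  have h := tendsto_gammaKernelIntegral hν (l := 𝓝[>] 0)
    (g := fun s => exp (-s) * s ^ (ν - 1)) fun s hs => by
      have hc : Continuous fun x : ℝ => s ^ (ν - 1) * exp (-s - x ^ 2 / 4 / s) := by fun_prop
      have := (hc.tendsto 0).mono_left (nhdsWithin_le_nhds (s := Ioi 0))
      simpa [mul_comm] using this
  rw [← Gamma_eq_integral hν] at h
  refine (h.const_mul (2 ^ (ν - 1))).congr' ?_
  filter_upwards [self_mem_nhdsWithin] with x hx using (rpow_mul_besselK ν hx).symm

theorem tendsto_rpow_mul_besselK_atTop {ν : ℝ} (hν : 0 < ν) :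
    Tendsto (fun x => x ^ ν * besselK ν x) atTop (𝓝 0) := by
  have h := tendsto_gammaKernelIntegral hν (l := atTop) (g := fun _ => 0) fun s hs => by
    have h1 : Tendsto (fun x : ℝ => x ^ 2 / 4 / s) atTop atTop :=
      ((tendsto_pow_atTop two_ne_zero).atTop_div_const (by norm_num)).atTop_div_const hs
    have h2 : Tendsto (fun x : ℝ => -s - x ^ 2 / 4 / s) atTop atBot := by
      simpa only [sub_eq_add_neg, Function.comp_def] using
        tendsto_atBot_add_const_left atTop (-s) (tendsto_neg_atTop_atBot.comp h1)
    simpa using (tendsto_exp_atBot.comp h2).const_mul (s ^ (ν - 1))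
  have h2 := h.const_mul (2 ^ (ν - 1))
  simp only [integral_zero, mul_zero] at h2
  refine h2.congr' ?_
  filter_upwards [eventually_gt_atTop 0] with x hx using (rpow_mul_besselK ν hx).symm

/-! ### The total integral of `t^ν K_ν(t)` -/

theorem integral_exp_neg_sq_div {s : ℝ} (hs : 0 < s) :
    ∫ t in Ioi (0 : ℝ), exp (-(t ^ 2 / 4 / s)) = √π * s ^ (1 / 2 : ℝ) := by
  have h := integral_gaussian_Ioi (1 / (4 * s))
  rw [show (fun t : ℝ => exp (-(t ^ 2 / 4 / s))) = fun t : ℝ => exp (-(1 / (4 * s)) * t ^ 2) by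
    funext t; congr 1; field_simp, h, ← sqrt_eq_rpow, ← sqrt_mul pi_pos.le,
    show π / (1 / (4 * s)) = 2 ^ 2 * (π * s) by field_simp; norm_num,
    sqrt_mul (by norm_num), sqrt_sq (by norm_num)]
  ring

/-- Integrating the Gaussian in `t` first leaves `√π s^(ν - 1/2) e^(-s)`, integrable because `ν >
-1/2`. -/
theorem integrable_prod_gammaKernel {ν : ℝ} (hν : -(1 / 2) < ν) :
    Integrable (Function.uncurry fun t s : ℝ => s ^ (ν - 1) * exp (-s - t ^ 2 / 4 / s))
      ((volume.restrict (Ioi 0)).prod (volume.restrict (Ioi 0))) := by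
  have hm : Measurable (Function.uncurry fun t s : ℝ =>
      s ^ (ν - 1) * exp (-s - t ^ 2 / 4 / s)) := by
    unfold Function.uncurry; fun_prop
  rw [integrable_prod_iff' hm.aestronglyMeasurable]
  constructor
  · refine (ae_restrict_iff' measurableSet_Ioi).2 (ae_of_all _ fun s (hs : 0 < s) => ?_)
    have h := ((integrable_exp_neg_mul_sq (show 0 < 1 / (4 * s) by positivity)).integrableOn
      (s := Ioi 0)).const_mul (s ^ (ν - 1) * exp (-s))
    refine h.congr (ae_of_all _ fun t => ?_)
    simp only [Function.uncurry_apply_pair]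
    rw [mul_assoc, ← exp_add]
    congr 2
    field_simp
    ring
  · refine IntegrableOn.congr_fun ((integrableOn_rpow_mul_exp_neg
      (show -1 < ν - 1 / 2 by linarith)).const_mul √π) (fun s (hs : 0 < s) => ?_) measurableSet_Ioi
    have e : ∀ t : ℝ, ‖Function.uncurry (fun t s : ℝ => s ^ (ν - 1) * exp (-s - t ^ 2 / 4 / s))
        (t, s)‖ = s ^ (ν - 1) * exp (-s) * exp (-(t ^ 2 / 4 / s)) := fun t => by
      rw [Function.uncurry_apply_pair, norm_of_nonneg (by positivity), sub_eq_add_neg (-s), exp_add]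
      ring
    simp only [e]
    rw [integral_const_mul, integral_exp_neg_sq_div hs,
      show ν - 1 / 2 = ν - 1 + 1 / 2 by ring, rpow_add hs]
    ring

theorem integrableOn_rpow_mul_besselK {ν : ℝ} (hν : -(1 / 2) < ν) :
    IntegrableOn (fun t => t ^ ν * besselK ν t) (Ioi 0) := by
  refine IntegrableOn.congr_fun ((integrable_prod_gammaKernel hν).integral_prod_left.const_mul
    (2 ^ (ν - 1))) (fun t ht => (rpow_mul_besselK ν ht).symm) measurableSet_Ioi

theorem integral_rpow_mul_besselK {ν : ℝ} (hν : -(1 / 2) < ν) :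
    ∫ t in Ioi (0 : ℝ), t ^ ν * besselK ν t = √π * 2 ^ (ν - 1) * Gamma (ν + 1 / 2) := by
  rw [setIntegral_congr_fun measurableSet_Ioi fun t ht => rpow_mul_besselK ν ht,
    integral_const_mul]
  simp only [gammaKernelIntegral]
  rw [integral_integral_swap (integrable_prod_gammaKernel hν),
    Gamma_eq_integral (by linarith), mul_right_comm, mul_comm, ← integral_const_mul (√π)]
  congr 1
  refine setIntegral_congr_fun measurableSet_Ioi fun s (hs : 0 < s) => ?_
  simp only [sub_eq_add_neg (-s), exp_add]
  simp only [← mul_assoc]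
  rw [integral_const_mul, integral_exp_neg_sq_div hs,
    show ν + 1 / 2 - 1 = ν - 1 + 1 / 2 by ring, rpow_add hs]
  ring

/-! ### Monotonicity of `K_{ν-1} / K_ν` -/

theorem cosh_mul_cosh_lt {ν s t : ℝ} (hν : 1 / 2 < ν) (hs : 0 < s) (hst : s < t) :
    cosh (ν * s) * cosh ((ν - 1) * t) < cosh (ν * t) * cosh ((ν - 1) * s) := by
  -- After product-to-sum, the larger argument minus and plus the smaller one gives `t - s` and `(2ν
  -- - 1)(t + s)` in one pair, `(2ν - 1)(t - s)` and `t + s` in the other; all are positive.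
  have h1 : 0 < (2 * ν - 1) * (t + s) := mul_pos (by linarith) (by linarith)
  have h2 : 0 < (2 * ν - 1) * (t - s) := mul_pos (by linarith) (by linarith)
  have e : ∀ a b : ℝ, cosh a * cosh b = (cosh (a + b) + cosh (a - b)) / 2 := fun a b => by
    rw [cosh_add, cosh_sub]; ring
  have k1 : cosh (ν * s + (ν - 1) * t) < cosh (ν * t + (ν - 1) * s) := by
    rw [cosh_lt_cosh]
    refine lt_of_lt_of_le (abs_lt.2 ⟨?_, ?_⟩) (le_abs_self _) <;> linarith
  have k2 : cosh (ν * s - (ν - 1) * t) < cosh (ν * t - (ν - 1) * s) := by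
    rw [cosh_lt_cosh]
    refine lt_of_lt_of_le (abs_lt.2 ⟨?_, ?_⟩) (le_abs_self _) <;> linarith
  rw [e, e]
  linarith

theorem integral_exp_mul_cosh_combination (ν a b : ℝ) {x : ℝ} (hx : 0 < x) :
    IntegrableOn (fun t => exp (-x * cosh t) * (a * cosh (ν * t) - b * cosh ((ν - 1) * t)))
      (Ioi 0) ∧
    ∫ t in Ioi (0 : ℝ), exp (-x * cosh t) * (a * cosh (ν * t) - b * cosh ((ν - 1) * t)) =
      a * besselK ν x - b * besselK (ν - 1) x := by
  have h1 := ((integrable_besselK ν hx).integrableOn (s := Ioi 0)).const_mul a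
  have h2 := ((integrable_besselK (ν - 1) hx).integrableOn (s := Ioi 0)).const_mul b
  have e : ∀ t, exp (-x * cosh t) * (a * cosh (ν * t) - b * cosh ((ν - 1) * t)) =
      a * (exp (-x * cosh t) * cosh (ν * t)) - b * (exp (-x * cosh t) * cosh ((ν - 1) * t)) :=
    fun t => by ring
  simp only [e]
  refine ⟨h1.sub h2, ?_⟩
  rw [integral_sub h1 h2, integral_const_mul, integral_const_mul, besselK, besselK]

/-- For `ν > 1 / 2` the ratio `K_{ν - 1} / K_ν` is strictly increasing. -/
theorem besselK_sub_one_mul_lt {ν x y : ℝ} (hν : 1 / 2 < ν) (hx : 0 < x) (hxy : x < y) :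
    besselK (ν - 1) x * besselK ν y < besselK ν x * besselK (ν - 1) y := by
  set A := besselK ν x
  set B := besselK (ν - 1) x
  have hA : 0 < A := besselK_pos ν hx
  have hB : 0 < B := besselK_pos _ hx
  -- These weights make `∫ exp(-x cosh t) g` vanish, and the claim is that `∫ exp(-y cosh t) g < 0`.
  -- The function `g` changes sign once, from minus to plus, while the extra factor `exp(-(y - x)
  -- cosh t)` decreases and so favours the negative part.
  set g : ℝ → ℝ := fun t => B * cosh (ν * t) - A * cosh ((ν - 1) * t) with hg
  have hgc : Continuous g := by fun_prop
  obtain ⟨hi, hI⟩ := integral_exp_mul_cosh_combination ν B A hx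
  obtain ⟨hi', hI'⟩ := integral_exp_mul_cosh_combination ν B A (hx.trans hxy)
  have hI0 : ∫ t in Ioi (0 : ℝ), exp (-x * cosh t) * g t = 0 := by rw [hI]; ring
  -- Without a zero, continuity would give `g` a constant sign, contradicting the vanishing
  -- integral.
  obtain ⟨t₀, ht₀, h₀⟩ : ∃ t₀, 0 < t₀ ∧ g t₀ = 0 := by
    by_contra! hne
    by_cases hs : ∃ t, 0 < t ∧ g t < 0
    · obtain ⟨t, ht, htn⟩ := hs
      have hneg : ∀ u, 0 < u → g u < 0 := fun u hu => by
        by_contra! hgu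
        obtain ⟨w, hw, hw0⟩ := isPreconnected_Ioi.intermediate_value (s := Ioi (0 : ℝ))
          (show t ∈ Ioi 0 from ht) (show u ∈ Ioi 0 from hu) hgc.continuousOn ⟨htn.le, hgu⟩
        exact hne w hw hw0
      have := setIntegral_Ioi_pos hi.neg 0
        (fun u hu => by
          have := mul_pos (exp_pos (-x * cosh u)) (neg_pos.2 (hneg u hu))
          simp only [Pi.neg_apply]; linarith)
        (fun u hu _ => by
          have := mul_pos (exp_pos (-x * cosh u)) (neg_pos.2 (hneg u hu))
          simp only [Pi.neg_apply]; linarith)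
      simp only [Pi.neg_apply] at this
      rw [integral_neg, hI0] at this
      simp at this
    · push Not at hs
      have hpos : ∀ u, 0 < u → 0 < exp (-x * cosh u) * g u := fun u hu =>
        mul_pos (exp_pos _) (lt_of_le_of_ne (hs u hu) (hne u hu).symm)
      exact (setIntegral_Ioi_pos hi 0 (fun u hu => (hpos u hu).le)
        fun u hu _ => hpos u hu).ne' hI0
  have hc₀ : 0 < cosh ((ν - 1) * t₀) := cosh_pos _
  have hgt : ∀ t, g t * cosh ((ν - 1) * t₀) =
      B * (cosh (ν * t) * cosh ((ν - 1) * t₀) - cosh (ν * t₀) * cosh ((ν - 1) * t)) := fun t => by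
    simp only [hg] at h₀ ⊢
    linear_combination cosh ((ν - 1) * t) * h₀
  -- Adding this constant multiple of the zero integral makes both factors change sign together at
  -- `t₀`.
  have hfac : ∀ t, exp (-((y - x) * cosh t₀)) * (exp (-x * cosh t) * g t) -
      exp (-y * cosh t) * g t =
      (exp (-x * cosh t + -((y - x) * cosh t₀)) - exp (-y * cosh t)) * g t := fun t => by
    rw [exp_add]; ring
  have hpos : ∀ t, 0 < t → t ≠ t₀ → 0 < exp (-((y - x) * cosh t₀)) * (exp (-x * cosh t) * g t) -
      exp (-y * cosh t) * g t := fun t ht hne => by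
    rw [hfac]
    rcases lt_or_gt_of_ne hne with hlt | hlt
    · have hg0 : g t < 0 := by
        have := mul_pos hB (sub_pos.2 (cosh_mul_cosh_lt hν ht hlt))
        have h := hgt t
        by_contra! hc
        have := mul_nonneg hc hc₀.le
        linarith
      have hcosh : cosh t < cosh t₀ := by
        rw [cosh_lt_cosh, abs_of_pos ht, abs_of_pos ht₀]; exact hlt
      refine mul_pos_of_neg_of_neg (sub_neg.2 (exp_lt_exp.2 ?_)) hg0
      have := mul_pos (sub_pos.2 hxy) (sub_pos.2 hcosh)
      linarith
    · have hg0 : 0 < g t := by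
        have := mul_pos hB (sub_pos.2 (cosh_mul_cosh_lt hν ht₀ hlt))
        rw [← hgt t] at this
        exact pos_of_mul_pos_left this hc₀.le
      have hcosh : cosh t₀ < cosh t := by
        rw [cosh_lt_cosh, abs_of_pos ht, abs_of_pos ht₀]; exact hlt
      refine mul_pos (sub_pos.2 (exp_lt_exp.2 ?_)) hg0
      have := mul_pos (sub_pos.2 hxy) (sub_pos.2 hcosh)
      linarith
  have hfin := setIntegral_Ioi_pos ((hi.const_mul (exp (-((y - x) * cosh t₀)))).sub hi') t₀
    (fun t ht => by
      rcases eq_or_ne t t₀ with rfl | hne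
      · have : B * cosh (ν * t) - A * cosh ((ν - 1) * t) = 0 := h₀
        simp [this]
      · exact (hpos t ht hne).le) hpos
  simp only [Pi.sub_apply] at hfin
  rw [integral_sub (hi.const_mul _) hi', integral_const_mul, hI, hI'] at hfin
  linarith

/-! ### The `K`–`𝐋` combination and the bounds of (i) -/

theorem struveL_pos {ν x : ℝ} (hν : -(3 / 2) < ν) (hx : 0 < x) : 0 < struveL ν x := by
  rw [struveL_eq]; exact besselStruve_pos (by norm_num) (by linarith) hx

theorem hasDerivAt_besselK_struveL (ν : ℝ) {x : ℝ} (hx : 0 < x) :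
    HasDerivAt
      (fun x => 1 - x * (besselK ν x * struveL (ν - 1) x + besselK (ν - 1) x * struveL ν x))
      (-(struveConst ν * (x ^ ν * besselK ν x))) x := by
  have hK := hasDerivAt_besselK' (ν - 1) hx
  rw [sub_add_cancel] at hK
  convert! ((hasDerivAt_id x).mul (((hasDerivAt_besselK ν hx).mul
    (hasDerivAt_struveL_sub_one ν hx)).add (hK.mul (hasDerivAt_struveL ν hx)))).const_sub 1 using 1
  rw [show x ^ ν = x ^ (ν - 1) * x by rw [← rpow_add_one hx.ne']; ring_nf]
  simp only [id, Pi.add_apply, Pi.mul_apply]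
  field_simp
  ring

theorem tendsto_besselK_struveL_zero {ν : ℝ} (hν : 1 / 2 < ν) :
    Tendsto
      (fun x => 1 - x * (besselK ν x * struveL (ν - 1) x + besselK (ν - 1) x * struveL ν x))
      (𝓝[>] 0) (𝓝 1) := by
  have hK := tendsto_rpow_mul_besselK_zero (show 0 < ν by linarith)
  have h1 := hK.mul (tendsto_rpow_mul_struveL (a := 1 - ν) (ν := ν - 1) (by linarith))
  have h2 := hK.mul (tendsto_rpow_mul_struveL (a := 1 - ν) (ν := ν) (by linarith))
  rw [mul_zero] at h1 h2
  have e : ∀ x : ℝ, 0 < x → ∀ u v : ℝ, x ^ ν * u * (x ^ (1 - ν) * v) = x * (u * v) :=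
    fun x hx u v => by
      have : x ^ ν * x ^ (1 - ν) = x := by rw [← rpow_add hx]; simp
      linear_combination (u * v) * this
  -- The order `ν - 1` may be nonpositive, so `K_{ν-1}` is bounded by `K_ν` instead of using its own
  -- limit.
  have h3 : Tendsto (fun x => x * (besselK (ν - 1) x * struveL ν x)) (𝓝[>] 0) (𝓝 0) := by
    refine tendsto_of_tendsto_of_tendsto_of_le_of_le' tendsto_const_nhds h2 ?_ ?_
    · filter_upwards [self_mem_nhdsWithin] with x (hx : 0 < x)
      have := besselK_pos (ν - 1) hx
      have := struveL_pos (show -(3 / 2) < ν by linarith) hx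
      positivity
    · filter_upwards [self_mem_nhdsWithin] with x (hx : 0 < x)
      rw [e x hx]
      have := besselK_sub_one_lt hν hx
      have := struveL_pos (show -(3 / 2) < ν by linarith) hx
      gcongr
  have h4 := (h1.add h3).const_sub 1
  rw [add_zero, sub_zero] at h4
  refine h4.congr' ?_
  filter_upwards [self_mem_nhdsWithin] with x (hx : 0 < x)
  rw [e x hx, mul_add]

/-- No asymptotics of `𝐋` are needed: the derivative is integrable, so a limit exists, and it equals
`1 - c ∫₀^∞ t^ν K_ν = 0`. -/
theorem tendsto_besselK_struveL_atTop {ν : ℝ} (hν : 1 / 2 < ν) :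
    Tendsto
      (fun x => 1 - x * (besselK ν x * struveL (ν - 1) x + besselK (ν - 1) x * struveL ν x))
      atTop (𝓝 0) := by
  set G : ℝ → ℝ := fun x =>
    1 - x * (besselK ν x * struveL (ν - 1) x + besselK (ν - 1) x * struveL ν x)
  have hint : IntegrableOn (fun t => -(struveConst ν * (t ^ ν * besselK ν t))) (Ioi 0) :=
    ((integrableOn_rpow_mul_besselK (by linarith)).const_mul _).neg
  have hd : ∀ x ∈ Ioi (0 : ℝ), HasDerivAt G (-(struveConst ν * (x ^ ν * besselK ν x))) x :=
    fun x hx => hasDerivAt_besselK_struveL ν hx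
  have hlim := tendsto_limUnder_of_hasDerivAt_of_integrableOn_Ioi hd hint
  -- The factor `x` makes the value at `0` agree with the right limit, whatever the other factors
  -- are there.
  have hG0 : G 0 = 1 := by simp [G]
  have hcont : ContinuousWithinAt G (Ici 0) 0 := by
    rw [← continuousWithinAt_Ioi_iff_Ici, ContinuousWithinAt, hG0]
    exact tendsto_besselK_struveL_zero hν
  have hI := integral_Ioi_of_hasDerivAt_of_tendsto hcont hd hint hlim
  have hc : struveConst ν * (√π * 2 ^ (ν - 1) * Gamma (ν + 1 / 2)) = 1 := by
    have := Gamma_pos_of_pos (show 0 < ν + 1 / 2 by linarith)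
    have := pi_pos
    exact one_div_mul_cancel (by positivity)
  rw [integral_neg, integral_const_mul, integral_rpow_mul_besselK (by linarith), hc, hG0] at hI
  rwa [show limUnder atTop G = 0 by linarith] at hlim

/-- A function on `(a, ∞)` with negative derivative lies above its limit at infinity. -/
theorem lt_of_tendsto_atTop_of_hasDerivAt_neg {f f' : ℝ → ℝ} {l x : ℝ}
    (hf : ∀ y, x ≤ y → HasDerivAt f (f' y) y) (hf' : ∀ y, x < y → f' y < 0)
    (hl : Tendsto f atTop (𝓝 l)) : l < f x := by
  have hm : StrictAntiOn f (Ici x) := by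
    refine strictAntiOn_of_deriv_neg (convex_Ici x)
      (fun y hy => (hf y hy).continuousAt.continuousWithinAt) fun y hy => ?_
    rw [interior_Ici] at hy
    rw [(hf y (le_of_lt hy)).deriv]
    exact hf' y hy
  have h1 : x ≤ x + 1 := by linarith
  refine lt_of_le_of_lt (le_of_tendsto hl ?_) (hm self_mem_Ici h1 (lt_add_one x))
  filter_upwards [eventually_ge_atTop (x + 1)] with y hy
  exact hm.antitoneOn h1 (h1.trans hy) hy

/-- Both sides vanish at infinity, and their difference has derivative `-c x^ν (K_ν - K_{ν-1}) < 0`.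
-/
theorem rpow_mul_besselK_lt {ν x : ℝ} (hν : 1 / 2 < ν) (hx : 0 < x) :
    struveConst ν * (x ^ ν * besselK ν x) <
      1 - x * (besselK ν x * struveL (ν - 1) x + besselK (ν - 1) x * struveL ν x) := by
  have hlim := (tendsto_besselK_struveL_atTop hν).sub
    ((tendsto_rpow_mul_besselK_atTop (show 0 < ν by linarith)).const_mul (struveConst ν))
  rw [mul_zero, sub_zero] at hlim
  refine sub_pos.1 (lt_of_tendsto_atTop_of_hasDerivAt_neg (f := fun x =>
    1 - x * (besselK ν x * struveL (ν - 1) x + besselK (ν - 1) x * struveL ν x) -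
      struveConst ν * (x ^ ν * besselK ν x))
    (fun y hy => (hasDerivAt_besselK_struveL ν (hx.trans_le hy)).sub
      ((hasDerivAt_rpow_mul_besselK ν (hx.trans_le hy)).const_mul (struveConst ν)))
    (fun y hy => ?_) hlim)
  have hy0 : 0 < y := hx.trans hy
  have h1 := struveConst_pos (show -(1 / 2) < ν by linarith)
  have h2 : 0 < struveConst ν * y ^ ν * (besselK ν y - besselK (ν - 1) y) :=
    mul_pos (by positivity) (sub_pos.2 (besselK_sub_one_lt hν hy0))
  linarith

theorem lt_rpow_mul_besselK {ν x : ℝ} (hν : 1 / 2 < ν) (hx : 0 < x) :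
    1 - x * (besselK ν x * struveL (ν - 1) x + besselK (ν - 1) x * struveL ν x) <
      1 / (2 ^ (ν - 1) * Gamma ν) * (x ^ ν * besselK ν x) := by
  have hν0 : 0 < ν := by linarith
  have hΓ := Gamma_pos_of_pos hν0
  set M := 1 / (2 ^ (ν - 1) * Gamma ν) with hM
  have hM0 : 0 < M := by positivity
  set c := struveConst ν
  set D : ℝ → ℝ := fun x => M * (x ^ ν * besselK ν x) -
    (1 - x * (besselK ν x * struveL (ν - 1) x + besselK (ν - 1) x * struveL ν x)) with hDdef
  have hD : ∀ y, 0 < y → HasDerivAt D (y ^ ν * (c * besselK ν y - M * besselK (ν - 1) y)) y :=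
    fun y hy => by
      convert! ((hasDerivAt_rpow_mul_besselK ν hy).const_mul M).sub
        (hasDerivAt_besselK_struveL ν hy) using 1
      ring
  have hlim0 : Tendsto D (𝓝[>] 0) (𝓝 0) := by
    convert! ((tendsto_rpow_mul_besselK_zero hν0).const_mul M).sub
      (tendsto_besselK_struveL_zero hν) using 2
    rw [hM, one_div_mul_cancel (by positivity), sub_self]
  have hlim1 : Tendsto D atTop (𝓝 0) := by
    convert! ((tendsto_rpow_mul_besselK_atTop hν0).const_mul M).sub
      (tendsto_besselK_struveL_atTop hν) using 2
    rw [mul_zero, sub_zero]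
  refine sub_pos.1 (show 0 < D x from ?_)
  -- Either `D` increases from `0` up to `x`, or `D'` is nonpositive somewhere before `x`. In the
  -- second case the increasing ratio keeps `D'` negative beyond `x`, and `D` decreases to `0` at
  -- infinity.
  by_cases h : ∀ y, 0 < y → y < x → 0 < y ^ ν * (c * besselK ν y - M * besselK (ν - 1) y)
  · exact lt_of_tendsto_nhdsGT_of_hasDerivAt_pos hx (fun y hy _ => hD y hy) h hlim0
  · push Not at h
    obtain ⟨y, hy, hyx, hle⟩ := h
    have hle' : c * besselK ν y ≤ M * besselK (ν - 1) y := by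
      by_contra! hc
      exact hle.not_gt (mul_pos (by positivity) (sub_pos.2 hc))
    refine lt_of_tendsto_atTop_of_hasDerivAt_neg (fun z hz => hD z (hx.trans_le hz))
      (fun z hz => mul_neg_of_pos_of_neg (rpow_pos_of_pos (hx.trans hz) _) (sub_neg.2 ?_)) hlim1
    have hKy := besselK_pos ν hy
    have hKz := besselK_pos ν (hx.trans hz)
    have h1 := mul_lt_mul_of_pos_left (besselK_sub_one_mul_lt hν hy (hyx.trans hz)) hM0
    have h2 := mul_le_mul_of_nonneg_right hle' hKz.le
    refine lt_of_mul_lt_mul_right (a := besselK ν y) ?_ hKy.le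
    linarith

end

theorem mainTheorem5 :
    (∀ ν x : ℝ, 1 / 2 < ν → 0 < x →
      x ^ ν * besselK ν x / (√Real.pi * 2 ^ (ν - 1) * Real.Gamma (ν + 1 / 2)) <
          1 - x * (besselK ν x * struveL (ν - 1) x + besselK (ν - 1) x * struveL ν x) ∧
        1 - x * (besselK ν x * struveL (ν - 1) x + besselK (ν - 1) x * struveL ν x) <
          x ^ ν * besselK ν x / (2 ^ (ν - 1) * Real.Gamma ν)) ∧
    (∀ ν x : ℝ, -(1 / 2) < ν → 0 < x →
      x ^ (ν - 1) * besselI (ν + 1) x / (√Real.pi * 2 ^ (ν - 1) * Real.Gamma (ν + 1 / 2)) <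
          besselI ν x * struveL (ν - 1) x - besselI (ν - 1) x * struveL ν x ∧
        besselI ν x * struveL (ν - 1) x - besselI (ν - 1) x * struveL ν x <
          x ^ (ν - 1) * besselI (ν + 1) x / (√Real.pi * 2 ^ (ν - 1) * Real.Gamma (ν + 1 / 2)) *
            (1 + 1 / (2 * ν + 1) * (1 - besselI (ν + 3) x / besselI (ν + 1) x))) := by
  refine ⟨fun ν x hν hx => ?_, fun ν x hν hx => ?_⟩
  · have h1 := rpow_mul_besselK_lt hν hx
    have h2 := lt_rpow_mul_besselK hν hx
    rw [struveConst, one_div_mul_eq_div] at h1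
    rw [one_div_mul_eq_div] at h2
    exact ⟨h1, h2⟩
  · have h1 := rpow_mul_besselI_lt hν hx
    have h2 := lt_rpow_mul_besselI hν hx
    have e : x ^ ν = x ^ (ν - 1) * x := by rw [← Real.rpow_add_one hx.ne']; ring_nf
    have hI := besselI_pos (show -1 < ν + 1 by linarith) hx
    have hν' : 0 < 2 * ν + 1 := by linarith
    constructor
    -- The bounds were proved for `x` times the combination; cancelling `x` turns `x^ν` into
    -- `x^(ν-1)`.
    · refine lt_of_mul_lt_mul_left (a := x) (lt_of_eq_of_lt ?_ h1) hx.le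
      rw [e, struveConst]
      ring
    · refine lt_of_mul_lt_mul_left (a := x) (lt_of_lt_of_eq h2 ?_) hx.le
      rw [← one_div_mul_eq_div _ (x ^ (ν - 1) * besselI (ν + 1) x), ← struveConst, e]
      field_simp
      ring
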